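/- Let $X$ be a complex Banach space and let $(S(t))_{t\ge 0}$ be a locally bounded, strongly measurable semigroup of bounded linear operators on $X$ (strong continuity at $0$ is not assumed) with generator $-A\colon \mathsf D(A)\subseteq X\to X$, i.e. for all $\lambda\in\mathbb C$ with sufficiently large real part, $\lambda+A\colon \mathsf D(A)\to X$ is invertible with $(\lambda+A)^{-1}x=\int_0^\infty e^{-\lambda t}S(t)x\,dt$ for all $x\in X$. Suppose that the semigroup is uniformly exponentially stable: there are $M_0\ge 1$ and $w>0$ such that $\|S(t)\|\le M_0e^{-wt}$ for all $t\ge 0$. Let $n\in\{1,2,3,\dots\}$, $p\in[1,\infty]$, $t_0\in\mathbb R$ and $J=(t_0,\infty)$. View $\partial_t+A$ as an operator on the Bochner space $L^p(J;X)$ with domain $W^{1,p}(J;X)\cap L^p(J;\mathsf D(A))$, where $\partial_t$ is the weak derivative, $A$ acts pointwise almost everywhere and $\mathsf D(A)$ carries the graph norm; its powers are defined on their natural domains, i.e. $\mathsf D((\partial_t+A)^{0})=L^p(J;X)$, $(\partial_t+A)^0u=u$, and $\mathsf D((\partial_t+A)^{k+1})=\{u\in\mathsf D(\partial_t+A):(\partial_t+A)u\in\mathsf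 D((\partial_t+A)^k)\}$. For $f\in L^p(J;X)$ and $t\in\overline J=[t_0,\infty)$ put $$\mathfrak I^n_{t_0}f(t)=\frac1{\Gamma(n)}\int_{t_0}^t(t-\tau)^{n-1}S(t-\tau)f(\tau)\,d\tau .$$ If $u\in\mathsf D((\partial_t+A)^n)$, then for each $k\in\{0,\dots,n-1\}$ the function $(\partial_t+A)^ku$ has a (necessarily unique) continuous representative on $\overline J$, the Bochner integral defining $\mathfrak I^n_{t_0}(\partial_t+A)^nu(t)$ converges for every $t\in\overline J$, and, evaluating $u$ and $(\partial_t+A)^ku$ through these continuous representatives, $$u(t)=\mathfrak I^n_{t_0}(\partial_t+A)^nu(t)+\sum_{k=0}^{n-1}\frac{(t-t_0)^k}{k!}\,S(t-t_0)\,[(\partial_t+A)^ku](t_0)\qquad\text{for all }t\in\overline J .$$ -/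

import Mathlib

open MeasureTheory Set
open scoped ENNReal ContDiff

noncomputable section

namespace ParabolicCalculus

/-! ### Semigroups -/

/-- A locally bounded, strongly measurable semigroup `(S(t))_{t ≥ 0}` of bounded linear operators
on `X`. Only the values `S t` with `0 ≤ t` matter. No continuity at `0` is required. -/
structure IsMeasurableSemigroup {X : Type*} [NormedAddCommGroup X] [NormedSpace ℂ X]
    (S : ℝ → X →L[ℂ] X) : Prop where
  map_zero : S 0 = ContinuousLinearMap.id ℂ X
  map_add : ∀ s t : ℝ, 0 ≤ s → 0 ≤ t → S (s + t) = (S s).comp (S t)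
  measurable : ∀ x : X, AEStronglyMeasurable (fun t => S t x) (volume.restrict (Ici (0 : ℝ)))
  locallyBounded : ∀ T : ℝ, ∃ M : ℝ, ∀ t ∈ Icc (0 : ℝ) T, ‖S t‖ ≤ M

/-- Uniform exponential stability: `‖S(t)‖ ≤ M₀ e^{-wt}` for some `M₀ ≥ 1`, `w > 0`. -/
def IsUniformlyExpStable {X : Type*} [NormedAddCommGroup X] [NormedSpace ℂ X]
    (S : ℝ → X →L[ℂ] X) : Prop :=
  ∃ M₀ : ℝ, 1 ≤ M₀ ∧ ∃ w : ℝ, 0 < w ∧ ∀ t : ℝ, 0 ≤ t → ‖S t‖ ≤ M₀ * Real.exp (-(w * t))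

/-- The Laplace transform `∫₀^∞ e^{-zt} S(t)x dt`. -/
def laplace {X : Type*} [NormedAddCommGroup X] [NormedSpace ℂ X]
    (S : ℝ → X →L[ℂ] X) (z : ℂ) (x : X) : X :=
  ∫ t in Ioi (0 : ℝ), Complex.exp (-(z * (t : ℂ))) • S t x

/-- `B` is the (infinitesimal) generator of the strongly measurable semigroup `S`: for all `z` in
some right half-plane, `z - B : D(B) → X` is invertible, and its inverse is the (absolutely
convergent) Laplace transform of `S` at `z`. For strongly continuous semigroups this is the usual
generator; without strong continuity, `D(B)` need not be dense and this is the standard notion. -/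
def IsGenerator {X : Type*} [NormedAddCommGroup X] [NormedSpace ℂ X]
    (S : ℝ → X →L[ℂ] X) (B : X →ₗ.[ℂ] X) : Prop :=
  ∃ a : ℝ, ∀ z : ℂ, a < z.re →
    (∀ x : X, IntegrableOn (fun t : ℝ => Complex.exp (-(z * (t : ℂ))) • S t x) (Ioi 0)) ∧
    (∀ x : X, ∃ h : laplace S z x ∈ B.domain, z • laplace S z x - B ⟨laplace S z x, h⟩ = x) ∧
    (∀ y : B.domain, laplace S z (z • (y : X) - B y) = y)

/-! ### Composition and powers of unbounded operators -/

/-- The composition `g ∘ f` of two partially defined operators on its maximal domain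
`{x ∈ D(f) : f x ∈ D(g)}`. -/
def compPMap {E : Type*} [AddCommGroup E] [Module ℂ E] (g f : E →ₗ.[ℂ] E) : E →ₗ.[ℂ] E where
  domain := (g.domain.comap f.toFun).map f.domain.subtype
  toFun := g.toFun.comp
    (((f.toFun.comp (Submodule.inclusion (by
      rintro _ ⟨y, -, rfl⟩
      exact y.2 :
        (g.domain.comap f.toFun).map f.domain.subtype ≤ f.domain)))).codRestrict g.domain (by
      rintro ⟨_, ⟨y, hy, rfl⟩⟩
      exact hy))

theorem mem_compPMap_domain {E : Type*} [AddCommGroup E] [Module ℂ E] (g f : E →ₗ.[ℂ] E)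
    (x : E) : x ∈ (compPMap g f).domain ↔ ∃ h : x ∈ f.domain, f ⟨x, h⟩ ∈ g.domain := by
  constructor
  · rintro ⟨y, hy, rfl⟩
    exact ⟨y.2, hy⟩
  · rintro ⟨h, hx⟩
    exact ⟨⟨x, h⟩, hx, rfl⟩

theorem compPMap_apply {E : Type*} [AddCommGroup E] [Module ℂ E] (g f : E →ₗ.[ℂ] E)
    (x : E) (h : x ∈ f.domain) (h' : f ⟨x, h⟩ ∈ g.domain) (hx : x ∈ (compPMap g f).domain) :
    compPMap g f ⟨x, hx⟩ = g ⟨f ⟨x, h⟩, h'⟩ := rfl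

/-- The powers of an unbounded operator: `B⁰ = id` on the whole space and `Bⁿ⁺¹ = Bⁿ ∘ B` on
`D(Bⁿ⁺¹) = {x ∈ D(B) : B x ∈ D(Bⁿ)}`. -/
def powPMap {E : Type*} [AddCommGroup E] [Module ℂ E] (B : E →ₗ.[ℂ] E) : ℕ → E →ₗ.[ℂ] E
  | 0 => (LinearMap.id : E →ₗ[ℂ] E).toPMap ⊤
  | n + 1 => compPMap (powPMap B n) B

theorem mem_powPMap_domain_of_le {E : Type*} [AddCommGroup E] [Module ℂ E] {B : E →ₗ.[ℂ] E}
    {k n : ℕ} (hkn : k ≤ n) {x : E} (hx : x ∈ (powPMap B n).domain) :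
    x ∈ (powPMap B k).domain := by
  induction n generalizing k x with
  | zero =>
    obtain rfl : k = 0 := by omega
    exact hx
  | succ n ih =>
    cases k with
    | zero => exact Submodule.mem_top
    | succ k =>
      obtain ⟨h, h'⟩ := (mem_compPMap_domain _ _ _).1 hx
      exact (mem_compPMap_domain _ _ _).2 ⟨h, ih (by omega) h'⟩

/-! ### The operator `∂ₜ + A` on `L^p(J; X)`, `J = (t₀, ∞)` -/

section

variable {X : Type*} [NormedAddCommGroup X] [NormedSpace ℂ X]

/-- The Bochner space `L^p(J; X)` for `J = (t₀, ∞)`. -/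
abbrev LpJ (X : Type*) [NormedAddCommGroup X] (p : ℝ≥0∞) (t₀ : ℝ) :=
  Lp X p (volume.restrict (Ioi t₀))

/-- `v` is the weak derivative of `u` on `J = (t₀, ∞)`. -/
def IsWeakDeriv {p : ℝ≥0∞} {t₀ : ℝ} (u v : LpJ X p t₀) : Prop :=
  ∀ φ : ℝ → ℝ, ContDiff ℝ ∞ φ → HasCompactSupport φ → tsupport φ ⊆ Ioi t₀ →
    ∫ t in Ioi t₀, deriv φ t • u t = -∫ t in Ioi t₀, φ t • v t

theorem integrable_test_smul {p : ℝ≥0∞} [hp : Fact (1 ≤ p)] {t₀ : ℝ} (u : LpJ X p t₀)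
    {φ : ℝ → ℝ} (hφ : Continuous φ) (hc : HasCompactSupport φ) :
    Integrable (fun t => φ t • u t) (volume.restrict (Ioi t₀)) :=
  ((Lp.memLp u).locallyIntegrable hp.out).integrable_smul_left_of_hasCompactSupport hφ hc

/-- The graph of the weak derivative on `L^p(J; X)`, as a subspace. -/
def weakDerivGraph (X : Type*) [NormedAddCommGroup X] [NormedSpace ℂ X]
    (p : ℝ≥0∞) [Fact (1 ≤ p)] (t₀ : ℝ) :
    Submodule ℂ (LpJ X p t₀ × LpJ X p t₀) where
  carrier := {q | IsWeakDeriv q.1 q.2}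
  zero_mem' := by
    intro φ hφ hc hs
    have h : ∀ ψ : ℝ → ℝ, ∫ t in Ioi t₀, ψ t • (0 : LpJ X p t₀) t = 0 := by
      intro ψ
      rw [← integral_zero ℝ X (μ := volume.restrict (Ioi t₀))]
      refine integral_congr_ae ?_
      filter_upwards [Lp.coeFn_zero X p (volume.restrict (Ioi t₀))] with t ht
      rw [ht]; simp
    simp only [Prod.fst_zero, Prod.snd_zero]
    rw [h, h, neg_zero]
  add_mem' := by
    rintro ⟨u, v⟩ ⟨u', v'⟩ h h' φ hφ hc hs
    have key : ∀ (ψ : ℝ → ℝ) (_ : Continuous ψ) (_ : HasCompactSupport ψ) (a b : LpJ X p t₀),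
        ∫ t in Ioi t₀, ψ t • (a + b) t
          = (∫ t in Ioi t₀, ψ t • a t) + ∫ t in Ioi t₀, ψ t • b t := by
      intro ψ h1 h2 a b
      rw [← integral_add (integrable_test_smul a h1 h2) (integrable_test_smul b h1 h2)]
      refine integral_congr_ae ?_
      filter_upwards [Lp.coeFn_add a b] with t ht
      rw [ht, Pi.add_apply, smul_add]
    have e := h φ hφ hc hs
    have e' := h' φ hφ hc hs
    simp only [Prod.fst_add, Prod.snd_add] at *
    rw [key _ (hφ.continuous_deriv (by simp)) hc.deriv, key _ hφ.continuous hc, e, e', neg_add]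
  smul_mem' := by
    rintro c ⟨u, v⟩ h φ hφ hc hs
    have key : ∀ (ψ : ℝ → ℝ) (a : LpJ X p t₀),
        ∫ t in Ioi t₀, ψ t • (c • a) t = c • ∫ t in Ioi t₀, ψ t • a t := by
      intro ψ a
      rw [← integral_smul]
      refine integral_congr_ae ?_
      filter_upwards [Lp.coeFn_smul c a] with t ht
      rw [ht, Pi.smul_apply, smul_comm]
    have e := h φ hφ hc hs
    simp only [Prod.smul_fst, Prod.smul_snd] at *
    rw [key, key, e, smul_neg]

/-- The weak time derivative `∂ₜ` as an operator on `L^p(J; X)` with domain `W^{1,p}(J; X)`. -/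
def weakDeriv (X : Type*) [NormedAddCommGroup X] [NormedSpace ℂ X]
    (p : ℝ≥0∞) [Fact (1 ≤ p)] (t₀ : ℝ) : LpJ X p t₀ →ₗ.[ℂ] LpJ X p t₀ :=
  (weakDerivGraph X p t₀).toLinearPMap

theorem mem_weakDeriv_graph [CompleteSpace X] {p : ℝ≥0∞} [hp : Fact (1 ≤ p)] {t₀ : ℝ}
    (u v : LpJ X p t₀) : (u, v) ∈ (weakDeriv X p t₀).graph ↔ IsWeakDeriv u v := by
  rw [weakDeriv, Submodule.toLinearPMap_graph_eq]
  · rfl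
  · rintro ⟨u, v⟩ h h0
    have h0 : u = 0 := h0
    subst h0
    have hz := (weakDerivGraph X p t₀).zero_mem
    have h2 := isOpen_Ioi.ae_eq_zero_of_integral_contDiff_smul_eq_zero (U := Ioi t₀)
      (μ := volume.restrict (Ioi t₀)) (f := v)
      (((Lp.memLp v).locallyIntegrable hp.out).locallyIntegrableOn _) (by
        intro φ hφ hc hs
        have e := h φ hφ hc hs
        have e' := hz φ hφ hc hs
        have h3 : ∫ t in Ioi t₀, φ t • (0 : LpJ X p t₀) t = 0 := by
          rw [← integral_zero ℝ X (μ := volume.restrict (Ioi t₀))]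
          refine integral_congr_ae ?_
          filter_upwards [Lp.coeFn_zero X p (volume.restrict (Ioi t₀))] with t ht
          rw [ht]; simp
        simp only [Prod.fst_zero, Prod.snd_zero] at e e'
        rw [h3] at e'
        rw [e'] at e
        simpa using e.symm)
    refine (Lp.eq_zero_iff_ae_eq_zero).2 ?_
    filter_upwards [h2, ae_restrict_mem measurableSet_Ioi] with t ht ht'
    exact ht ht'

/-- The graph of the pointwise action of `A`: all `(u, v) ∈ L^p(J; X)²` such that for almost every
`t ∈ J` one has `u(t) ∈ D(A)` and `A u(t) = v(t)`. -/
def multGraph (A : X →ₗ.[ℂ] X) (p : ℝ≥0∞) (t₀ : ℝ) :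
    Submodule ℂ (LpJ X p t₀ × LpJ X p t₀) where
  carrier := {q | ∀ᵐ t ∂(volume.restrict (Ioi t₀)), (q.1 t, q.2 t) ∈ A.graph}
  zero_mem' := by
    change ∀ᵐ t ∂_, _
    filter_upwards [Lp.coeFn_zero X p (volume.restrict (Ioi t₀))] with t ht
    simp only [Prod.fst_zero, Prod.snd_zero, ht]
    exact A.graph.zero_mem
  add_mem' := by
    rintro ⟨u, v⟩ ⟨u', v'⟩ h h'
    change ∀ᵐ t ∂_, _ at h h'
    change ∀ᵐ t ∂_, _
    filter_upwards [h, h', Lp.coeFn_add u u', Lp.coeFn_add v v'] with t h1 h2 h3 h4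
    simp only [Prod.fst_add, Prod.snd_add, h3, h4]
    exact A.graph.add_mem h1 h2
  smul_mem' := by
    rintro c ⟨u, v⟩ h
    change ∀ᵐ t ∂_, _ at h
    change ∀ᵐ t ∂_, _
    filter_upwards [h, Lp.coeFn_smul c u, Lp.coeFn_smul c v] with t h1 h3 h4
    simp only [Prod.smul_fst, Prod.smul_snd, h3, h4]
    exact A.graph.smul_mem c h1

/-- The operator `[𝒜u](t) = A u(t)` on `L^p(J; X)` with domain `L^p(J; D(A))`. Here `D(A)` carries
the graph norm, so that `L^p(J; D(A))` consists of all `u ∈ L^p(J; X)` with `u(t) ∈ D(A)` for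
almost every `t` and `A u(·) ∈ L^p(J; X)`. -/
def multOp (A : X →ₗ.[ℂ] X) (p : ℝ≥0∞) (t₀ : ℝ) : LpJ X p t₀ →ₗ.[ℂ] LpJ X p t₀ :=
  (multGraph A p t₀).toLinearPMap

theorem mem_multOp_graph (A : X →ₗ.[ℂ] X) {p : ℝ≥0∞} {t₀ : ℝ} (u v : LpJ X p t₀) :
    (u, v) ∈ (multOp A p t₀).graph ↔
      ∀ᵐ t ∂(volume.restrict (Ioi t₀)), (u t, v t) ∈ A.graph := by
  rw [multOp, Submodule.toLinearPMap_graph_eq]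
  · rfl
  · rintro ⟨u, v⟩ h h0
    have h0 : u = 0 := h0
    subst h0
    change ∀ᵐ t ∂_, _ at h
    refine (Lp.eq_zero_iff_ae_eq_zero).2 ?_
    filter_upwards [h, Lp.coeFn_zero X p (volume.restrict (Ioi t₀))] with t h1 h2
    exact A.graph_fst_eq_zero_snd h1 h2

/-- The operator `∂ₜ + A` on `L^p(J; X)` with domain `W^{1,p}(J; X) ∩ L^p(J; D(A))`. -/
def parabolicOp (A : X →ₗ.[ℂ] X) (p : ℝ≥0∞) [Fact (1 ≤ p)] (t₀ : ℝ) :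
    LpJ X p t₀ →ₗ.[ℂ] LpJ X p t₀ :=
  weakDeriv X p t₀ + multOp A p t₀

/-- `g` is, on the closed half-line `[t₀, ∞)`, a continuous representative of `u ∈ L^p(J; X)`.
On `[t₀, ∞)` it is unique if it exists. -/
def IsContRep {p : ℝ≥0∞} {t₀ : ℝ} (u : LpJ X p t₀) (g : ℝ → X) : Prop :=
  ContinuousOn g (Ici t₀) ∧ u =ᵐ[volume.restrict (Ioi t₀)] g

/-! ### Riemann–Liouville type parabolic integral -/

/-- The integrand `τ ↦ (t - τ)^{s-1} S(t - τ) f(τ)`. -/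
def parabolicIntegrand (S : ℝ → X →L[ℂ] X) (s t : ℝ) (f : ℝ → X) (τ : ℝ) : X :=
  (t - τ) ^ (s - 1) • S (t - τ) (f τ)

/-- The Riemann–Liouville type fractional parabolic integral of order `s > 0`,
`Γ(s)⁻¹ ∫_{t₀}^t (t - τ)^{s-1} S(t - τ) f(τ) dτ`. -/
def parabolicIntegral (S : ℝ → X →L[ℂ] X) (s t₀ : ℝ) (f : ℝ → X) (t : ℝ) : X :=
  (1 / Real.Gamma s) • ∫ τ in t₀..t, parabolicIntegrand S s t f τ

end

end ParabolicCalculus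

end

open ParabolicCalculus

namespace ParabolicCalculus

/-! ### Integration by parts for operator-valued functions. -/

section Calculus

variable {E F : Type*} [NormedAddCommGroup E] [NormedSpace ℂ E]
  [NormedAddCommGroup F] [NormedSpace ℂ F]

/-! If `v' + A v = g`, then formally `d/dτ [a(t-τ) S(t-τ) v(τ)] = a(t-τ) S(t-τ) g(τ) - a'(t-τ)
S(t-τ) v(τ)`. Integrate this over `(t₀, t)` with `a(s) = s^k / k!` and with `v`, `g` the `k`-th and
`(k+1)`-st iterates of `∂ₜ + A` on `u`. Each order is thereby reduced to the previous one at the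
cost of one boundary term at `t₀`. The boundary term at `τ = t` survives only for `k = 0`, where it
is `u(t)`, and the sum telescopes to the formula.

The orbits of `S` need be neither differentiable nor continuous at `0`, so the computation is done
after applying `R²`, where `R = (l + A)⁻¹` is the Laplace transform of `S` at a large real `l`. One
factor `R` makes `S(·)R` locally Lipschitz in operator norm on `[0, ∞)`; the second makes `S(·)R²`
continuously differentiable (`exists_regularized_semigroup`). The equation is used in the bounded
form `R g = v - l R v + R v'`, and `integral_regularized_by_parts` gives the reduction. As `R` is
injective and commutes with `S`, it is cancelled at the end.

On the other side, `v` is only weakly differentiable. By du Bois-Reymond it is the primitive of its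
weak derivative, which gives the continuous representative up to `t₀`. The product rule is proved
for such primitives by Fubini, without pointwise derivatives. -/

theorem hasDerivAt_clm_apply_const {G : ℝ → E →L[ℂ] F} {T : E →L[ℂ] F} {τ : ℝ}
    (hG : HasDerivAt G T τ) (x : E) : HasDerivAt (fun τ => G τ x) (T x) τ :=
  ((ContinuousLinearMap.apply ℂ F x).restrictScalars ℝ).hasFDerivAt.comp_hasDerivAt τ hG

theorem integrable_clm_apply {μ : Measure ℝ} {G : ℝ → E →L[ℂ] F} {g : ℝ → E} {a b : ℝ}
    (hG : Continuous G) (hg : IntegrableOn g (Ioc a b) μ) :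
    IntegrableOn (fun τ => G τ (g τ)) (Ioc a b) μ := by
  obtain ⟨C, hC⟩ := isCompact_Icc.exists_bound_of_continuousOn (s := Icc a b) hG.continuousOn
  refine Integrable.mono' (hg.norm.const_mul C) ?_ ?_
  · exact ((ContinuousLinearMap.apply ℂ F).flip.isBoundedBilinearMap.continuous).comp_aestronglyMeasurable₂
      hG.aestronglyMeasurable hg.1
  · filter_upwards [ae_restrict_mem measurableSet_Ioc] with τ hτ
    exact ((G τ).le_opNorm _).trans (by gcongr; exact hC τ (Ioc_subset_Icc_self hτ))

/-- Fubini's theorem on a triangle, in the form needed for integration by parts. -/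
theorem integral_deriv_apply_primitive [CompleteSpace E] [CompleteSpace F]
    {G G' : ℝ → E →L[ℂ] F} (hG : ∀ τ, HasDerivAt G (G' τ) τ)
    (hG' : Continuous G') {g : ℝ → E} {a b : ℝ} (hab : a ≤ b)
    (hg : IntervalIntegrable g volume a b) :
    ∫ τ in a..b, G' τ (∫ s in a..τ, g s) = ∫ s in a..b, (G b - G s) (g s) := by
  have hg1 : IntegrableOn g (Ioc a b) := (intervalIntegrable_iff_integrableOn_Ioc_of_le hab).1 hg
  have hG1 : IntegrableOn G' (Ioc a b) := hG'.integrableOn_Ioc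
  -- Cutting off to `s ≤ τ` turns the triangle into a square, where the order of integration can be
  -- swapped.
  let H : ℝ → ℝ → F := fun τ s => (Iic τ).indicator (fun s => G' τ (g s)) s
  have hH : IntegrableOn (Function.uncurry H) (uIoc a b ×ˢ uIoc a b) := by
    rw [uIoc_of_le hab, IntegrableOn, Measure.volume_eq_prod, ← Measure.prod_restrict]
    have h1 : Integrable (fun z : ℝ × ℝ => G' z.1 (g z.2))
        ((volume.restrict (Ioc a b)).prod (volume.restrict (Ioc a b))) :=
      Integrable.op_fst_snd (op := fun (T : E →L[ℂ] F) x => T x) isBoundedBilinearMap_apply.continuous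
        ⟨1, fun T x => by simpa using T.le_opNorm x⟩ hG1 hg1
    have h2 : MeasurableSet {z : ℝ × ℝ | z.2 ≤ z.1} :=
      measurableSet_le measurable_snd measurable_fst
    refine (h1.indicator h2).congr (Filter.Eventually.of_forall fun z => ?_)
    simp only [H, Function.uncurry, indicator, mem_ofPred_eq, mem_Iic]
  have key := intervalIntegral_intervalIntegral_swap hH
  have e1 : ∫ τ in a..b, ∫ s in a..b, H τ s = ∫ τ in a..b, G' τ (∫ s in a..τ, g s) := by
    refine intervalIntegral.integral_congr fun τ hτ => ?_
    rw [uIcc_of_le hab] at hτ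
    simp only [H]
    have : (∫ s in a..b, (Iic τ).indicator (fun s => G' τ (g s)) s) =
      ∫ s in a..τ, G' τ (g s) := intervalIntegral.integral_indicator hτ
    rw [this, ContinuousLinearMap.intervalIntegral_comp_comm]
    exact hg.mono_set (by rw [uIcc_of_le hab, uIcc_of_le hτ.1]; exact Icc_subset_Icc_right hτ.2)
  have e2 : ∫ s in a..b, ∫ τ in a..b, H τ s = ∫ s in a..b, (G b - G s) (g s) := by
    refine intervalIntegral.integral_congr_ae (Filter.Eventually.of_forall fun s hs => ?_)
    rw [uIoc_of_le hab] at hs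
    have h3 : ∀ τ, H τ s = (Ici s).indicator (fun τ => G' τ (g s)) τ := fun τ => by
      simp only [H, indicator, mem_Iic, mem_Ici]
    have h4 : Ioc a b ∩ Ici s = Icc s b := by
      ext x; simp only [mem_inter_iff, mem_Ioc, mem_Ici, mem_Icc]
      exact ⟨fun h => ⟨h.2, h.1.2⟩, fun h => ⟨⟨hs.1.trans_le h.1, h.2⟩, h.1⟩⟩
    simp_rw [h3]
    rw [intervalIntegral.integral_of_le hab, setIntegral_indicator measurableSet_Ici, h4,
      integral_Icc_eq_integral_Ioc, ← intervalIntegral.integral_of_le hs.2]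
    have h5 : ∀ τ, HasDerivAt (fun τ => G τ (g s)) (G' τ (g s)) τ := fun τ =>
      hasDerivAt_clm_apply_const (hG τ) (g s)
    rw [intervalIntegral.integral_eq_sub_of_hasDerivAt (fun τ _ => h5 τ)]
    · simp
    · exact (hG'.clm_apply continuous_const).intervalIntegrable _ _
  rw [← e1, key, e2]

/-- The product rule, in integrated form, for a continuously differentiable operator-valued
function and an absolutely continuous function. -/
theorem integral_deriv_clm_apply [CompleteSpace E] [CompleteSpace F]
    {G G' : ℝ → E →L[ℂ] F} (hG : ∀ τ, HasDerivAt G (G' τ) τ)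
    (hG' : Continuous G') {g : ℝ → E} {a b : ℝ} (hab : a ≤ b)
    (hg : IntervalIntegrable g volume a b) {h : ℝ → E}
    (hh : ∀ τ ∈ Icc a b, h τ = h a + ∫ s in a..τ, g s) :
    ∫ τ in a..b, (G' τ (h τ) + G τ (g τ)) = G b (h b) - G a (h a) := by
  have hGc : Continuous G := continuous_iff_continuousAt.2 fun τ => (hG τ).continuousAt
  have hg1 : IntegrableOn g (Ioc a b) := (intervalIntegrable_iff_integrableOn_Ioc_of_le hab).1 hg
  have hp : ContinuousOn (fun τ => ∫ s in a..τ, g s) (uIcc a b) :=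
    intervalIntegral.continuousOn_primitive_interval' hg left_mem_uIcc
  have i1 : IntervalIntegrable (fun τ => G' τ (h a)) volume a b :=
    (hG'.clm_apply continuous_const).intervalIntegrable _ _
  have i2 : IntervalIntegrable (fun τ => G' τ (∫ s in a..τ, g s)) volume a b :=
    (hG'.continuousOn.clm_apply hp).intervalIntegrable
  have i3 : IntervalIntegrable (fun τ => G τ (g τ)) volume a b :=
    (intervalIntegrable_iff_integrableOn_Ioc_of_le hab).2 (integrable_clm_apply hGc hg1)
  have i4 : IntervalIntegrable (fun τ => G b (g τ)) volume a b :=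
    (intervalIntegrable_iff_integrableOn_Ioc_of_le hab).2
      (integrable_clm_apply continuous_const hg1)
  have e : ∫ τ in a..b, (G' τ (h τ) + G τ (g τ)) =
      ∫ τ in a..b, ((G' τ (h a) + G' τ (∫ s in a..τ, g s)) + G τ (g τ)) := by
    refine intervalIntegral.integral_congr fun τ hτ => ?_
    rw [uIcc_of_le hab] at hτ
    simp only [hh τ hτ, map_add]
  have h5 : ∀ τ, HasDerivAt (fun τ => G τ (h a)) (G' τ (h a)) τ := fun τ =>
    hasDerivAt_clm_apply_const (hG τ) (h a)
  rw [e, intervalIntegral.integral_add (i1.add i2) i3, intervalIntegral.integral_add i1 i2,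
    integral_deriv_apply_primitive hG hG' hab hg,
    intervalIntegral.integral_eq_sub_of_hasDerivAt (fun τ _ => h5 τ) i1]
  simp only [sub_apply]
  rw [intervalIntegral.integral_sub i4 i3, ContinuousLinearMap.intervalIntegral_comp_comm _ hg,
    hh b (right_mem_Icc.2 hab), map_add]
  abel

end Calculus

/-! ### Weak derivatives on a half-line and primitives. -/

section WeakDerivative

variable {X : Type*} [NormedAddCommGroup X] [NormedSpace ℂ X]

theorem exists_tsupport_subset_Icc {φ : ℝ → ℝ} {t₀ : ℝ} (hc : HasCompactSupport φ)
    (hs : tsupport φ ⊆ Ioi t₀) : ∃ a b, t₀ < a ∧ a ≤ b ∧ tsupport φ ⊆ Icc a b := by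
  -- The extra point `t₀ + 1` keeps the compact set nonempty when `φ = 0`, so that its extrema
  -- exist.
  have hK : IsCompact (insert (t₀ + 1) (tsupport φ)) := IsCompact.insert hc _
  have hK' : insert (t₀ + 1) (tsupport φ) ⊆ Ioi t₀ := insert_subset (by simp) hs
  obtain ⟨a, ha⟩ := hK.exists_isLeast ⟨_, mem_insert _ _⟩
  obtain ⟨b, hb⟩ := hK.exists_isGreatest ⟨_, mem_insert _ _⟩
  exact ⟨a, b, hK' ha.1, ha.2 hb.1,
    fun x hx => ⟨ha.2 (mem_insert_of_mem _ hx), hb.2 (mem_insert_of_mem _ hx)⟩⟩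

theorem setIntegral_Ioi_eq_intervalIntegral {Y : Type*} [NormedAddCommGroup Y] [NormedSpace ℝ Y]
    {f : ℝ → Y} {t₀ b : ℝ} (hb : t₀ ≤ b)
    (hf : ∀ t, b < t → f t = 0) : ∫ t in Ioi t₀, f t = ∫ t in t₀..b, f t := by
  rw [intervalIntegral.integral_of_le hb]
  refine (setIntegral_eq_of_subset_of_forall_sdiff_eq_zero measurableSet_Ioi Ioc_subset_Ioi_self
    fun t ht => hf t ?_)
  by_contra h
  exact ht.2 ⟨ht.1, not_lt.1 h⟩

/-- A test function on a half-line with integral zero is the derivative of a test function. -/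
theorem exists_test_primitive {χ : ℝ → ℝ} {t₀ : ℝ} (hχ : ContDiff ℝ ∞ χ)
    (hc : HasCompactSupport χ) (hs : tsupport χ ⊆ Ioi t₀) (h0 : ∫ t in Ioi t₀, χ t = 0) :
    ∃ φ : ℝ → ℝ, ContDiff ℝ ∞ φ ∧ HasCompactSupport φ ∧ tsupport φ ⊆ Ioi t₀ ∧ deriv φ = χ := by
  obtain ⟨a, b, ha, hab, hK⟩ := exists_tsupport_subset_Icc hc hs
  have hz : ∀ t, t ∉ Icc a b → χ t = 0 := fun t ht => image_eq_zero_of_notMem_tsupport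
    fun h => ht (hK h)
  let φ : ℝ → ℝ := fun t => ∫ s in t₀..t, χ s
  have hd : ∀ t, HasDerivAt φ (χ t) t := fun t => intervalIntegral.integral_hasDerivAt_right
    (hχ.continuous.intervalIntegrable _ _)
    hχ.continuous.aestronglyMeasurable.stronglyMeasurableAtFilter hχ.continuous.continuousAt
  have hd' : deriv φ = χ := funext fun t => (hd t).deriv
  -- Left of `a` the primitive is still zero; right of `b` it equals the full integral, which
  -- vanishes by `h0`.
  have hsupp : tsupport φ ⊆ Icc a b := by
    refine closure_minimal (fun t ht => ?_) isClosed_Icc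
    by_contra h
    refine ht ?_
    rw [mem_Icc, not_and_or, not_le, not_le] at h
    rcases h with h | h
    · refine (intervalIntegral.integral_congr (g := fun _ => (0 : ℝ)) fun s hs => ?_).trans
        (by simp)
      refine hz s fun hs' => ?_
      have := hs'.1.trans hs.2
      exact absurd this (not_le.2 (max_lt ha h))
    · change ∫ s in t₀..t, χ s = 0
      rw [← setIntegral_Ioi_eq_intervalIntegral (by linarith) fun s hs => hz s fun hs' =>
        absurd hs'.2 (not_le.2 (h.trans hs)), h0]
  refine ⟨φ, ?_, ?_, fun t ht => ha.trans_le (hsupp ht).1, hd'⟩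
  · rw [contDiff_infty_iff_deriv]
    exact ⟨fun t => (hd t).differentiableAt, hd' ▸ hχ⟩
  · exact isCompact_Icc.of_isClosed_subset (isClosed_tsupport _) hsupp

/-- The lemma of du Bois-Reymond on a half-line. -/
theorem exists_ae_eq_const_of_integral_deriv_smul_eq_zero [CompleteSpace X] {w : ℝ → X} {t₀ : ℝ}
    (hw : LocallyIntegrable w (volume.restrict (Ioi t₀)))
    (h : ∀ φ : ℝ → ℝ, ContDiff ℝ ∞ φ → HasCompactSupport φ → tsupport φ ⊆ Ioi t₀ →
      ∫ t in Ioi t₀, deriv φ t • w t = 0) :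
    ∃ c, ∀ᵐ t ∂(volume.restrict (Ioi t₀)), w t = c := by
  -- The support is the closed ball of radius `1` about `t₀ + 2`, hence inside `(t₀, ∞)`.
  let f : ContDiffBump (t₀ + 2) := ⟨1 / 2, 1, by norm_num, by norm_num⟩
  let η : ℝ → ℝ := f.normed volume
  have hη : ContDiff ℝ ∞ η := f.contDiff_normed
  have hηc : HasCompactSupport η := f.hasCompactSupport_normed
  have hηs : tsupport η ⊆ Ioi t₀ := by
    rw [show tsupport η = Metric.closedBall (t₀ + 2) 1 from f.tsupport_normed_eq]
    intro t ht
    rw [Real.closedBall_eq_Icc] at ht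
    have := ht.1
    rw [mem_Ioi]; linarith
  have hz : ∀ {ψ : ℝ → ℝ}, tsupport ψ ⊆ Ioi t₀ → ∫ t in Ioi t₀, ψ t = ∫ t, ψ t := fun hs =>
    setIntegral_eq_integral_of_forall_compl_eq_zero fun t ht =>
      image_eq_zero_of_notMem_tsupport fun h => ht (hs h)
  have hη1 : ∫ t in Ioi t₀, η t = 1 := (hz hηs).trans f.integral_normed
  have hint : ∀ {ψ : ℝ → ℝ}, Continuous ψ → HasCompactSupport ψ →
      Integrable (fun t => ψ t • w t) (volume.restrict (Ioi t₀)) := fun h1 h2 =>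
    hw.integrable_smul_left_of_hasCompactSupport h1 h2
  let c : X := ∫ t in Ioi t₀, η t • w t
  refine ⟨c, ?_⟩
  have key := isOpen_Ioi.ae_eq_zero_of_integral_contDiff_smul_eq_zero (U := Ioi t₀)
      (μ := volume.restrict (Ioi t₀)) (f := fun t => w t - c)
      ((hw.sub (locallyIntegrable_const c)).locallyIntegrableOn _) (by
    intro ψ hψ hψc hψs
    let m : ℝ := ∫ t in Ioi t₀, ψ t
    have hψi : Integrable ψ (volume.restrict (Ioi t₀)) :=
      (hψ.continuous.integrable_of_hasCompactSupport hψc).restrict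
    have hηi : Integrable η (volume.restrict (Ioi t₀)) :=
      (hη.continuous.integrable_of_hasCompactSupport hηc).restrict
    have hmc : HasCompactSupport fun t => m * η t := hηc.mul_left (f := fun _ => m)
    -- Subtracting `m η` removes the mean of `ψ`, so the difference is an admissible `φ'`; the
    -- hypothesis then says `∫ ψ w = m c`.
    obtain ⟨φ, h1, h2, h3, h4⟩ := exists_test_primitive (χ := fun t => ψ t - m * η t) (t₀ := t₀)
      (hψ.sub (contDiff_const.mul hη)) (hψc.sub hmc)
      ((tsupport_sub _ _).trans (union_subset hψs ((tsupport_mul_subset_right (f := fun _ => m)).trans hηs)))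
      (by rw [integral_sub hψi (hηi.const_mul m), integral_const_mul, hη1]; simp [m])
    have e := h φ h1 h2 h3
    rw [h4] at e
    have e1 : ∫ t in Ioi t₀, (ψ t - m * η t) • w t = (∫ t in Ioi t₀, ψ t • w t) - m • c := by
      simp only [sub_smul, mul_smul]
      rw [integral_sub (hint hψ.continuous hψc) (g := fun t => m • η t • w t)
        ((hint hη.continuous hηc).smul m), integral_smul]
    simp only [smul_sub]
    rw [integral_sub (hint hψ.continuous hψc) (hψi.smul_const c), integral_smul_const, ← e1, e])
  filter_upwards [key, ae_restrict_mem measurableSet_Ioi] with t ht ht'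
  exact sub_eq_zero.1 (ht ht')

/-- Local integrability refers to compact subsets of `ℝ`, which may contain `t₀`; hence primitives
can be started at the endpoint itself. -/
theorem integrableOn_of_locallyIntegrable_restrict {Y : Type*} [NormedAddCommGroup Y]
    {v : ℝ → Y} {t₀ : ℝ}
    (hv : LocallyIntegrable v (volume.restrict (Ioi t₀))) (t : ℝ) : IntegrableOn v (Ioc t₀ t) := by
  have := (hv.integrableOn_isCompact (isCompact_Icc (a := t₀) (b := t))).mono_set Ioc_subset_Icc_self
  rwa [IntegrableOn, Measure.restrict_restrict measurableSet_Ioc,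
    inter_eq_left.2 Ioc_subset_Ioi_self] at this

theorem intervalIntegrable_of_locallyIntegrable_restrict {Y : Type*} [NormedAddCommGroup Y]
    {v : ℝ → Y} {t₀ t : ℝ}
    (hv : LocallyIntegrable v (volume.restrict (Ioi t₀))) (ht : t₀ ≤ t) :
    IntervalIntegrable v volume t₀ t :=
  (intervalIntegrable_iff_integrableOn_Ioc_of_le ht).2
    (integrableOn_of_locallyIntegrable_restrict hv t)

theorem continuousOn_primitive_Ici {v : ℝ → X} {t₀ : ℝ}
    (hv : LocallyIntegrable v (volume.restrict (Ioi t₀))) :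
    ContinuousOn (fun t => ∫ s in t₀..t, v s) (Ici t₀) := by
  intro t ht
  have ht' : t₀ ≤ t + 1 := by rw [mem_Ici] at ht; linarith
  have h1 := intervalIntegral.continuousOn_primitive_interval'
    (intervalIntegrable_of_locallyIntegrable_restrict hv ht') left_mem_uIcc
  rw [uIcc_of_le ht'] at h1
  refine (h1 t ⟨ht, by simp⟩).mono_of_mem_nhdsWithin ?_
  rw [← Ici_inter_Iic]
  exact Filter.inter_mem self_mem_nhdsWithin (mem_nhdsWithin_of_mem_nhds (Iic_mem_nhds (by simp)))

/-- A locally integrable function with locally integrable weak derivative is, up to a constant,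
the primitive of its weak derivative. -/
theorem exists_ae_eq_const_add_primitive [CompleteSpace X] {u v : ℝ → X} {t₀ : ℝ}
    (hu : LocallyIntegrable u (volume.restrict (Ioi t₀)))
    (hv : LocallyIntegrable v (volume.restrict (Ioi t₀)))
    (h : ∀ φ : ℝ → ℝ, ContDiff ℝ ∞ φ → HasCompactSupport φ → tsupport φ ⊆ Ioi t₀ →
      ∫ t in Ioi t₀, deriv φ t • u t = -∫ t in Ioi t₀, φ t • v t) :
    ∃ c, u =ᵐ[volume.restrict (Ioi t₀)] fun t => c + ∫ s in t₀..t, v s := by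
  have hcont := continuousOn_primitive_Ici hv
  have hloc : LocallyIntegrable (fun t => ∫ s in t₀..t, v s) (volume.restrict (Ioi t₀)) := by
    rw [restrict_Ioi_eq_restrict_Ici]
    exact (locallyIntegrableOn_iff_locallyIntegrable_restrict isClosed_Ici).1
      (hcont.locallyIntegrableOn measurableSet_Ici)
  obtain ⟨c, hc⟩ := exists_ae_eq_const_of_integral_deriv_smul_eq_zero (hu.sub hloc) (by
    intro φ h1 h2 h3
    obtain ⟨a, b, ha, hab, hK⟩ := exists_tsupport_subset_Icc h2 h3
    have hz : ∀ t, t ∉ Icc a b → φ t = 0 := fun t ht => image_eq_zero_of_notMem_tsupport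
      fun h => ht (hK h)
    have hφd : ∀ t, HasDerivAt φ (deriv φ t) t := fun t =>
      ((h1.differentiable (by simp)) t).hasDerivAt
    have hd1 : Continuous (deriv φ) := h1.continuous_deriv (by simp)
    have hz' : ∀ t, t ∉ Icc a b → deriv φ t = 0 := fun t ht => image_eq_zero_of_notMem_tsupport
      fun h => ht (hK (tsupport_deriv_subset (𝕜 := ℝ) h))
    -- The upper limit `b + 1` lies outside the support interval, so both boundary terms of the
    -- product rule vanish.
    have htb : t₀ ≤ b + 1 := by linarith
    have hvi := intervalIntegrable_of_locallyIntegrable_restrict hv htb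
    have key := integral_deriv_clm_apply (G := fun t => φ t • ContinuousLinearMap.id ℂ X)
      (G' := fun t => deriv φ t • ContinuousLinearMap.id ℂ X)
      (fun t => HasDerivAt.smul_const (hφd t) (ContinuousLinearMap.id ℂ X)) (hd1.smul continuous_const) htb hvi
      (h := fun t => ∫ s in t₀..t, v s) (by simp)
    have hb : b + 1 ∉ Icc a b := by simp
    have ht0 : t₀ ∉ Icc a b := fun h => absurd h.1 (not_le.2 ha)
    simp only [FunLike.coe_smul, Pi.smul_apply, ContinuousLinearMap.id_apply, hz _ hb, hz _ ht0,
      zero_smul, zero_apply, sub_zero] at key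
    rw [← setIntegral_Ioi_eq_intervalIntegral htb (fun t ht => by
      have : t ∉ Icc a b := fun h => by linarith [h.2]
      rw [hz t this, hz' t this]; simp),
      integral_add (hloc.integrable_smul_left_of_hasCompactSupport hd1 h2.deriv)
      (hv.integrable_smul_left_of_hasCompactSupport h1.continuous h2)] at key
    simp only [Pi.sub_apply, smul_sub]
    rw [integral_sub (hu.integrable_smul_left_of_hasCompactSupport hd1 h2.deriv)
      (hloc.integrable_smul_left_of_hasCompactSupport hd1 h2.deriv), h φ h1 h2 h3, sub_eq_zero]
    exact (eq_neg_of_add_eq_zero_left key).symm)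
  refine ⟨c, ?_⟩
  filter_upwards [hc] with t ht
  rw [← ht]; simp

end WeakDerivative

/-! ### The resolvent and the regularized semigroup. -/

section Resolvent

variable {X : Type*} [NormedAddCommGroup X] [NormedSpace ℂ X]

theorem IsUniformlyExpStable.exists_norm_le {S : ℝ → X →L[ℂ] X} (hexp : IsUniformlyExpStable S) :
    ∃ M : ℝ, 0 ≤ M ∧ ∀ t, 0 ≤ t → ‖S t‖ ≤ M := by
  obtain ⟨M, hM, w, hw, h⟩ := hexp
  refine ⟨M, by linarith, fun t ht => (h t ht).trans ?_⟩
  have : Real.exp (-(w * t)) ≤ 1 := Real.exp_le_one_iff.2 (by nlinarith)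
  nlinarith

theorem exp_neg_mul_smul (l t : ℝ) (x : X) :
    Complex.exp (-((l : ℂ) * (t : ℂ))) • x = Real.exp (-(l * t)) • x := by
  rw [← Complex.coe_smul (Real.exp (-(l * t))) x]
  push_cast
  rfl

theorem setIntegral_Ioi_comp_add_right (f : ℝ → X) (r : ℝ) :
    ∫ s in Ioi 0, f (s + r) = ∫ s in Ioi r, f s := by
  rw [← (measurePreserving_add_right volume r).setIntegral_preimage_emb
    (measurableEmbedding_addRight r) f (Ioi r)]
  simp

/-- The semigroup law shifts the Laplace integral: `e^{-lr} S(r) R x` is the same integral taken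
over `(r, ∞)`. This yields the last formula, which replaces differentiability of the orbits. -/
theorem exists_resolvent [CompleteSpace X] {S : ℝ → X →L[ℂ] X} {A : X →ₗ.[ℂ] X}
    (hS : IsMeasurableSemigroup S) (hA : IsGenerator S (-A)) (hexp : IsUniformlyExpStable S) :
    ∃ (l : ℝ) (R : X →L[ℂ] X), 0 < l ∧ Function.Injective R ∧
      (∀ x y, (x, y) ∈ A.graph → R (l • x + y) = x) ∧
      (∀ t, 0 ≤ t → ∀ x, R (S t x) = S t (R x)) ∧
      ∀ r, 0 ≤ r → ∀ x, IntervalIntegrable (fun s => Real.exp (-(l * s)) • S s x) volume 0 r ∧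
        Real.exp (-(l * r)) • S r (R x) = R x - ∫ s in 0..r, Real.exp (-(l * s)) • S s x := by
  obtain ⟨M, hM, hSM⟩ := hexp.exists_norm_le
  obtain ⟨a, ha⟩ := hA
  -- `l` lies in the half-plane of the generator condition, and is positive so that `e^{-ls}` is
  -- integrable and at most `1`.
  let l : ℝ := max a 0 + 1
  have hl : 0 < l := by positivity
  have hal : a < l := (le_max_left a 0).trans_lt (lt_add_one _)
  obtain ⟨h1, h2, h3⟩ := ha (l : ℂ) (by simpa using hal)
  simp only [laplace, exp_neg_mul_smul] at h1 h2 h3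
  let L : X →ₗ[ℂ] X :=
    { toFun := fun x => ∫ t in Ioi (0 : ℝ), Real.exp (-(l * t)) • S t x
      map_add' := fun x y => by
        simp only [map_add, smul_add]
        exact integral_add (h1 x) (h1 y)
      map_smul' := fun c x => by
        simp only [map_smul, smul_comm _ c, RingHom.id_apply]
        exact integral_smul _ _ }
  let R : X →L[ℂ] X := L.mkContinuous (∫ t in Ioi (0 : ℝ), Real.exp (-(l * t)) * M) (by
    intro x
    rw [← integral_mul_const]
    refine norm_integral_le_of_norm_le ?_ ?_
    · refine Integrable.mul_const (Integrable.mul_const ?_ _) _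
      have := integrableOn_exp_mul_Ioi (neg_lt_zero.2 hl) 0
      simpa [neg_mul, IntegrableOn] using this
    · filter_upwards [ae_restrict_mem measurableSet_Ioi] with t ht
      rw [norm_smul, Real.norm_of_nonneg (Real.exp_pos _).le, mul_assoc]
      gcongr
      exact ((S t).le_opNorm x).trans (by gcongr; exact hSM t (le_of_lt ht)))
  have hR : ∀ x, R x = ∫ t in Ioi (0 : ℝ), Real.exp (-(l * t)) • S t x := fun x => rfl
  have hcomm : ∀ t s, 0 ≤ t → 0 ≤ s → ∀ x, S t (S s x) = S (t + s) x := fun t s ht hs x => by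
    rw [hS.map_add t s ht hs]; rfl
  refine ⟨l, R, hl, ?_, ?_, ?_, ?_⟩
  · refine (injective_iff_map_eq_zero R).2 fun x hx => ?_
    obtain ⟨h, e⟩ := h2 x
    have h0 : (⟨∫ t in Ioi (0 : ℝ), Real.exp (-(l * t)) • S t x, h⟩ : (-A).domain) = 0 :=
      Subtype.ext hx
    rw [h0, LinearPMap.map_zero, sub_zero, ← hR, hx, smul_zero] at e
    exact e.symm
  · intro x y hxy
    obtain ⟨z, hz1, hz2⟩ := (LinearPMap.mem_graph_iff A).1 hxy
    have := h3 z
    rw [LinearPMap.neg_apply, sub_neg_eq_add] at this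
    simp only [hz1, hz2] at this
    rw [hR]
    rw [← Complex.coe_smul]
    exact this
  · intro t ht x
    rw [hR, hR, ← ContinuousLinearMap.integral_comp_comm _ (h1 x)]
    refine setIntegral_congr_fun measurableSet_Ioi fun s hs => ?_
    simp only [ContinuousLinearMap.map_smul_of_tower, hcomm s t (le_of_lt hs) ht, hcomm t s ht (le_of_lt hs),
      add_comm t s]
  · intro r hr x
    have hi : IntegrableOn (fun s => Real.exp (-(l * s)) • S s x) (Ioi r) :=
      (h1 x).mono_set (Ioi_subset_Ioi hr)
    refine ⟨(intervalIntegrable_iff_integrableOn_Ioc_of_le hr).2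
      ((h1 x).mono_set Ioc_subset_Ioi_self), ?_⟩
    rw [hR, ← intervalIntegral.integral_Ioi_sub_Ioi (h1 x) hr, sub_sub_cancel,
      ← ContinuousLinearMap.integral_comp_comm _ (h1 x), ← integral_smul]
    rw [← setIntegral_Ioi_comp_add_right fun s => Real.exp (-(l * s)) • S s x]
    refine setIntegral_congr_fun measurableSet_Ioi fun s hs => ?_
    simp only [ContinuousLinearMap.map_smul_of_tower, hcomm r s hr (le_of_lt hs), smul_smul, ← Real.exp_add]
    rw [add_comm r s]
    congr 2
    ring

/-- By the integral formula for the resolvent, `e^{-lr} S(r) R` is Lipschitz in operator norm and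
`e^{-lr} S(r) R²` is a primitive of its negative. Only the values at `t ≥ 0` are tied to `S`; the
extension to `ℝ` permits two-sided derivatives. -/
theorem exists_regularized_semigroup [CompleteSpace X] {S : ℝ → X →L[ℂ] X} {A : X →ₗ.[ℂ] X}
    (hS : IsMeasurableSemigroup S) (hA : IsGenerator S (-A)) (hexp : IsUniformlyExpStable S) :
    ∃ (l : ℝ) (R : X →L[ℂ] X) (E E' : ℝ → X →L[ℂ] X), Function.Injective R ∧
      (∀ x y, (x, y) ∈ A.graph → R (l • x + y) = x) ∧
      (∀ t, 0 ≤ t → ∀ x, R (S t x) = S t (R x)) ∧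
      (∀ t, 0 ≤ t → ∀ x, E t x = S t (R (R x))) ∧
      (∀ t, 0 ≤ t → ∀ x, E' t x = l • S t (R (R x)) - S t (R x)) ∧
      (∀ t, HasDerivAt E (E' t) t) ∧ Continuous E' := by
  obtain ⟨l, R, hl, hinj, hgraph, hcomm, hint⟩ := exists_resolvent hS hA hexp
  obtain ⟨M, hM, hSM⟩ := hexp.exists_norm_le
  -- The even extension keeps the Lipschitz bound on all of `ℝ`.
  let Q : ℝ → X →L[ℂ] X := fun s => Real.exp (-(l * |s|)) • (S |s|).comp R
  have hQ : ∀ s, 0 ≤ s → ∀ x, Q s x = Real.exp (-(l * s)) • S s (R x) := fun s hs x => by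
    simp [Q, abs_of_nonneg hs]
  have hQ' : ∀ s, Q s = Q |s| := fun s => by simp [Q]
  have hLip1 : ∀ r r', 0 ≤ r → r ≤ r' → ‖Q r' - Q r‖ ≤ M * (r' - r) := by
    intro r r' hr hrr
    refine ContinuousLinearMap.opNorm_le_bound _ (by nlinarith) fun x => ?_
    have hr' := hr.trans hrr
    rw [sub_apply, hQ r hr, hQ r' hr', (hint r hr x).2, (hint r' hr' x).2, sub_sub_sub_cancel_left,
      norm_sub_rev,
      intervalIntegral.integral_interval_sub_left (hint r' hr' x).1 (hint r hr x).1]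
    refine (intervalIntegral.norm_integral_le_of_norm_le_const (C := M * ‖x‖) fun s hs => ?_).trans
      (le_of_eq ?_)
    · rw [uIoc_of_le hrr] at hs
      have hs0 : 0 ≤ s := hr.trans hs.1.le
      rw [norm_smul, Real.norm_of_nonneg (Real.exp_pos _).le]
      have e1 : Real.exp (-(l * s)) ≤ 1 := Real.exp_le_one_iff.2 (by nlinarith)
      have e2 : ‖S s x‖ ≤ M * ‖x‖ := ((S s).le_opNorm x).trans (by gcongr; exact hSM s hs0)
      nlinarith [norm_nonneg (S s x)]
    · rw [abs_of_nonneg (by linarith)]; ring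
  have hLip2 : ∀ r r', 0 ≤ r → 0 ≤ r' → ‖Q r' - Q r‖ ≤ M * |r' - r| := by
    intro r r' hr hr'
    rcases le_total r r' with h | h
    · rw [abs_of_nonneg (by linarith)]; exact hLip1 r r' hr h
    · rw [norm_sub_rev, abs_sub_comm, abs_of_nonneg (by linarith)]; exact hLip1 r' r hr' h
  have hQc : Continuous Q := by
    refine (LipschitzWith.of_dist_le_mul (K := ⟨M, hM⟩) fun r r' => ?_).continuous
    rw [dist_eq_norm, Real.dist_eq, hQ' r, hQ' r']
    exact (hLip2 _ _ (abs_nonneg _) (abs_nonneg _)).trans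
      (mul_le_mul_of_nonneg_left (abs_abs_sub_abs_le_abs_sub _ _) hM)
  let P : ℝ → X →L[ℂ] X := fun r => R.comp R - ∫ s in 0..r, Q s
  have hPd : ∀ r, HasDerivAt P (-Q r) r := fun r => by
    have := intervalIntegral.integral_hasDerivAt_right (hQc.intervalIntegrable 0 r)
      hQc.aestronglyMeasurable.stronglyMeasurableAtFilter hQc.continuousAt
    simpa using this.const_sub (R.comp R)
  have hP : ∀ r, 0 ≤ r → ∀ x, P r x = Real.exp (-(l * r)) • S r (R (R x)) := fun r hr x => by
    have e : (∫ s in 0..r, Q s) x = ∫ s in 0..r, Q s x :=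
      ((ContinuousLinearMap.apply ℂ X x).intervalIntegral_comp_comm
        (hQc.intervalIntegrable 0 r)).symm
    rw [(hint r hr (R x)).2]
    simp only [P, sub_apply, e, ContinuousLinearMap.comp_apply]
    congr 1
    refine intervalIntegral.integral_congr fun s hs => ?_
    rw [uIcc_of_le hr] at hs
    exact hQ s hs.1 x
  have hPc : Continuous P := continuous_iff_continuousAt.2 fun r => (hPd r).continuousAt
  have hexpd : ∀ r, HasDerivAt (fun r => Real.exp (l * r)) (l * Real.exp (l * r)) r := fun r => by
    have := ((hasDerivAt_id r).const_mul l).exp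
    simpa [mul_comm] using this
  have hcancel : ∀ (r : ℝ) (x : X), Real.exp (l * r) • Real.exp (-(l * r)) • x = x := fun r x => by
    rw [smul_smul, ← Real.exp_add]; simp
  refine ⟨l, R, fun r => Real.exp (l * r) • P r,
    fun r => Real.exp (l * r) • (-Q r) + (l * Real.exp (l * r)) • P r, hinj, hgraph, hcomm,
    fun t ht x => ?_, fun t ht x => ?_, fun t => HasDerivAt.smul (hexpd t) (hPd t), ?_⟩
  · simp [hP t ht, hcancel]
  · simp only [add_apply, FunLike.coe_smul, Pi.smul_apply, neg_apply, hP t ht, hQ t ht, mul_smul,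
      smul_neg, hcancel]
    abel
  · have : Continuous fun r => Real.exp (l * r) := by fun_prop
    exact (this.smul hQc.neg).add ((this.const_smul l).smul hPc)

end Resolvent

/-! ### Powers of the parabolic operator and continuous representatives. -/

section Operators

/-- The powers are defined with `B` applied first, whereas the recursion needs it applied last. -/
theorem powPMap_succ_apply {E : Type*} [AddCommGroup E] [Module ℂ E] (B : E →ₗ.[ℂ] E) (k : ℕ)
    (x : E) (hk : x ∈ (powPMap B k).domain) (hk' : x ∈ (powPMap B (k + 1)).domain) :
    ∃ h : powPMap B k ⟨x, hk⟩ ∈ B.domain,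
      B ⟨powPMap B k ⟨x, hk⟩, h⟩ = powPMap B (k + 1) ⟨x, hk'⟩ := by
  induction k generalizing x with
  | zero =>
    obtain ⟨h, h'⟩ := (mem_compPMap_domain _ _ _).1 hk'
    exact ⟨h, rfl⟩
  | succ k ih =>
    obtain ⟨h, h'⟩ := (mem_compPMap_domain _ _ _).1 hk'
    obtain ⟨_, h''⟩ := (mem_compPMap_domain _ _ _).1 hk
    exact ih (B ⟨x, h⟩) h'' h'

variable {X : Type*} [NormedAddCommGroup X] [NormedSpace ℂ X]

theorem exists_weakDeriv_of_mem_parabolicOp_domain [CompleteSpace X] {A : X →ₗ.[ℂ] X} {p : ℝ≥0∞}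
    [Fact (1 ≤ p)] {t₀ : ℝ} {u : LpJ X p t₀} (hu : u ∈ (parabolicOp A p t₀).domain) :
    ∃ d : LpJ X p t₀, IsWeakDeriv u d ∧
      ∀ᵐ t ∂(volume.restrict (Ioi t₀)), (u t, parabolicOp A p t₀ ⟨u, hu⟩ t - d t) ∈ A.graph := by
  have h1 : u ∈ (weakDeriv X p t₀).domain := hu.1
  have h2 : u ∈ (multOp A p t₀).domain := hu.2
  refine ⟨weakDeriv X p t₀ ⟨u, h1⟩,
    (mem_weakDeriv_graph _ _).1 ((weakDeriv X p t₀).mem_graph ⟨u, h1⟩), ?_⟩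
  have e : parabolicOp A p t₀ ⟨u, hu⟩ =
      weakDeriv X p t₀ ⟨u, h1⟩ + multOp A p t₀ ⟨u, h2⟩ := rfl
  filter_upwards [(mem_multOp_graph A _ _).1 ((multOp A p t₀).mem_graph ⟨u, h2⟩),
    Lp.coeFn_add (weakDeriv X p t₀ ⟨u, h1⟩) (multOp A p t₀ ⟨u, h2⟩)] with t ht ht'
  rw [e, ht', Pi.add_apply, add_sub_cancel_left]
  exact ht

theorem IsWeakDeriv.exists_isContRep [CompleteSpace X] {p : ℝ≥0∞} [hp : Fact (1 ≤ p)] {t₀ : ℝ}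
    {u d : LpJ X p t₀} (h : IsWeakDeriv u d) :
    ∃ c, IsContRep u fun t => c + ∫ s in t₀..t, d s := by
  have hd := (Lp.memLp d).locallyIntegrable hp.out
  obtain ⟨c, hc⟩ := exists_ae_eq_const_add_primitive
    ((Lp.memLp u).locallyIntegrable hp.out) hd h
  exact ⟨c, continuousOn_const.add (continuousOn_primitive_Ici hd), hc⟩

/-- The half-line `[t₀, ∞)` is the closure of its interior, so equality almost everywhere also fixes
the value at `t₀`. -/
theorem IsContRep.eqOn {X : Type*} [NormedAddCommGroup X] {p : ℝ≥0∞} {t₀ : ℝ} {u : LpJ X p t₀} {g g' : ℝ → X}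
    (h : IsContRep u g) (h' : IsContRep u g') : EqOn g g' (Ici t₀) := by
  have e : g =ᵐ[volume.restrict (Ici t₀)] g' := by
    rw [← restrict_Ioi_eq_restrict_Ici]
    exact h.2.symm.trans h'.2
  exact Measure.eqOn_of_ae_eq e h.1 h'.1 (by rw [interior_Ici, closure_Ioi])

theorem IsWeakDeriv.eq_add_primitive [CompleteSpace X] {p : ℝ≥0∞} [hp : Fact (1 ≤ p)] {t₀ : ℝ}
    {u d : LpJ X p t₀} (h : IsWeakDeriv u d) {v : ℝ → X} (hv : IsContRep u v) {t : ℝ}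
    (ht : t₀ ≤ t) : v t = v t₀ + ∫ s in t₀..t, d s := by
  obtain ⟨c, hc⟩ := h.exists_isContRep
  have e := hv.eqOn hc
  rw [e ht, e (mem_Ici.2 le_rfl)]
  simp

end Operators

/-! ### Strongly measurable operator families. -/

section Measurability

variable {α E F : Type*} [MeasurableSpace α] [NormedAddCommGroup E] [NormedSpace ℂ E]
  [NormedAddCommGroup F] [NormedSpace ℂ F]

/-- A strongly measurable family of operators applied to a strongly measurable function. -/
theorem aestronglyMeasurable_clm_apply {μ : Measure α} {T : α → E →L[ℂ] F}
    (hT : ∀ x, AEStronglyMeasurable (fun a => T a x) μ) {f : α → E}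
    (hf : AEStronglyMeasurable f μ) : AEStronglyMeasurable (fun a => T a (f a)) μ := by
  obtain ⟨g, hg, hfg⟩ := hf
  have hsimple : ∀ s : SimpleFunc α E, AEStronglyMeasurable (fun a => T a (s a)) μ := fun s => by
    have e : (fun a => T a (s a)) =
        fun a => ∑ x ∈ s.range, (s ⁻¹' {x}).indicator (fun a => T a x) a := by
      funext a
      rw [Finset.sum_eq_single (s a)]
      · simp [indicator]
      · intro x _ hx
        exact indicator_of_notMem (fun h => hx (Eq.symm h)) _
      · exact fun h => absurd (SimpleFunc.mem_range_self s a) h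
    rw [e]
    exact Finset.aestronglyMeasurable_fun_sum _ fun x _ =>
      (hT x).indicator (s.measurableSet_preimage {x})
  have hlim : AEStronglyMeasurable (fun a => T a (g a)) μ :=
    aestronglyMeasurable_of_tendsto_ae Filter.atTop (fun n => hsimple (hg.approx n))
      (Filter.Eventually.of_forall fun a =>
        ((T a).continuous.tendsto _).comp (hg.tendsto_approx a))
  exact hlim.congr (hfg.mono fun a ha => by simp only [ha])

end Measurability

/-! ### Convergence of the parabolic integral. -/

section ParabolicIntegral

variable {X : Type*} [NormedAddCommGroup X] [NormedSpace ℂ X]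

theorem parabolicIntegrand_natCast (S : ℝ → X →L[ℂ] X) (m : ℕ) (t : ℝ) (f : ℝ → X) (τ : ℝ) :
    parabolicIntegrand S ((m + 1 : ℕ) : ℝ) t f τ = (t - τ) ^ m • S (t - τ) (f τ) := by
  simp [parabolicIntegrand]

theorem intervalIntegrable_parabolicIntegrand {S : ℝ → X →L[ℂ] X}
    (hS : IsMeasurableSemigroup S) (m : ℕ) {t₀ t : ℝ} (ht : t₀ ≤ t) {f : ℝ → X}
    (hf : IntegrableOn f (Ioc t₀ t)) :
    IntervalIntegrable (parabolicIntegrand S ((m + 1 : ℕ) : ℝ) t f) volume t₀ t := by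
  rw [intervalIntegrable_iff_integrableOn_Ioc_of_le ht]
  simp only [funext (parabolicIntegrand_natCast S m t f)]
  obtain ⟨M, hM⟩ := hS.locallyBounded (t - t₀)
  have hmeas : ∀ x, AEStronglyMeasurable (fun τ => S (t - τ) x) (volume.restrict (Ioc t₀ t)) := by
    intro x
    have h1 := (Measure.measurePreserving_sub_left volume t).restrict_preimage
      (measurableSet_Ici (a := (0 : ℝ)))
    have h2 := (hS.measurable x).comp_quasiMeasurePreserving h1.quasiMeasurePreserving
    refine h2.mono_set fun τ hτ => ?_
    simpa using hτ.2
  refine Integrable.mono' (hf.norm.const_mul ((t - t₀) ^ m * M)) ?_ ?_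
  · have h3 : Continuous fun τ : ℝ => (t - τ) ^ m := by fun_prop
    exact h3.aestronglyMeasurable.smul (aestronglyMeasurable_clm_apply hmeas hf.1)
  · filter_upwards [ae_restrict_mem measurableSet_Ioc] with τ hτ
    have h0 : 0 ≤ t - τ := by linarith [hτ.2]
    have h0' : t - τ ≤ t - t₀ := by linarith [hτ.1]
    have hb : ‖S (t - τ)‖ ≤ M := hM _ ⟨h0, h0'⟩
    rw [norm_smul, Real.norm_of_nonneg (pow_nonneg h0 m), mul_assoc]
    refine mul_le_mul (by gcongr) (((S (t - τ)).le_opNorm _).trans (by gcongr)) (norm_nonneg _)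
      (pow_nonneg (h0.trans h0') m)

end ParabolicIntegral

/-! ### The regularized reduction step. -/

section Regularized

variable {X : Type*} [NormedAddCommGroup X] [NormedSpace ℂ X] [CompleteSpace X]

/-- Integration by parts for `τ ↦ a(t - τ) S(t - τ) R² v(τ)`, where `v' + A v = g` and `R` is a
resolvent of `-A`. -/
theorem integral_regularized_by_parts {S : ℝ → X →L[ℂ] X} {A : X →ₗ.[ℂ] X} {l : ℝ}
    {R : X →L[ℂ] X} {E E' : ℝ → X →L[ℂ] X}
    (hgraph : ∀ x y, (x, y) ∈ A.graph → R (l • x + y) = x)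
    (hE : ∀ t, 0 ≤ t → ∀ x, E t x = S t (R (R x)))
    (hE' : ∀ t, 0 ≤ t → ∀ x, E' t x = l • S t (R (R x)) - S t (R x))
    (hd : ∀ t, HasDerivAt E (E' t) t) (hc : Continuous E')
    {a a' : ℝ → ℝ} (ha : ∀ t, HasDerivAt a (a' t) t) (ha' : Continuous a')
    {t₀ t : ℝ} (ht : t₀ ≤ t) {f g d v : ℝ → X}
    (hf : IntegrableOn f (Ioc t₀ t)) (hg : IntegrableOn g (Ioc t₀ t))
    (hdi : IntegrableOn d (Ioc t₀ t))
    (hv : ∀ τ ∈ Icc t₀ t, v τ = v t₀ + ∫ s in t₀..τ, d s)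
    (hfv : f =ᵐ[volume.restrict (Ioc t₀ t)] v)
    (hA : ∀ᵐ τ ∂(volume.restrict (Ioc t₀ t)), (f τ, g τ - d τ) ∈ A.graph) :
    ∫ τ in t₀..t, a (t - τ) • E (t - τ) (g τ) =
      (∫ τ in t₀..t, a' (t - τ) • E (t - τ) (f τ)) + a 0 • E 0 (v t) -
        a (t - t₀) • E (t - t₀) (v t₀) := by
  have hEc : Continuous E := continuous_iff_continuousAt.2 fun τ => (hd τ).continuousAt
  have hac : Continuous a := continuous_iff_continuousAt.2 fun τ => (ha τ).continuousAt
  have hsub : Continuous fun τ : ℝ => t - τ := by fun_prop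
  have hsubd : ∀ τ, HasDerivAt (fun τ : ℝ => t - τ) (-1) τ := fun τ => by
    simpa using (hasDerivAt_id τ).const_sub t
  have key := integral_deriv_clm_apply (G := fun τ => a (t - τ) • E (t - τ))
    (G' := fun τ => -(a (t - τ) • E' (t - τ) + a' (t - τ) • E (t - τ)))
    (fun τ => by
      have := HasDerivAt.scomp τ (HasDerivAt.smul (ha (t - τ)) (hd (t - τ))) (hsubd τ)
      simpa [add_comm, Function.comp_def] using this)
    (((hac.comp hsub).smul (hc.comp hsub)).add ((ha'.comp hsub).smul (hEc.comp hsub))).neg ht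
    ((intervalIntegrable_iff_integrableOn_Ioc_of_le ht).2 hdi) hv
  have ig : IntervalIntegrable (fun τ => a (t - τ) • E (t - τ) (g τ)) volume t₀ t :=
    (intervalIntegrable_iff_integrableOn_Ioc_of_le ht).2
      (integrable_clm_apply ((hac.comp hsub).smul (hEc.comp hsub)) hg)
  have if' : IntervalIntegrable (fun τ => a' (t - τ) • E (t - τ) (f τ)) volume t₀ t :=
    (intervalIntegrable_iff_integrableOn_Ioc_of_le ht).2
      (integrable_clm_apply ((ha'.comp hsub).smul (hEc.comp hsub)) hf)
  have e : ∫ τ in t₀..t, (a (t - τ) • E (t - τ) (g τ) - a' (t - τ) • E (t - τ) (f τ)) =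
      a 0 • E 0 (v t) - a (t - t₀) • E (t - t₀) (v t₀) := by
    simp only [sub_self, FunLike.coe_smul, Pi.smul_apply] at key
    rw [← key, intervalIntegral.integral_of_le ht, intervalIntegral.integral_of_le ht]
    refine integral_congr_ae ?_
    filter_upwards [hfv, hA, ae_restrict_mem measurableSet_Ioc] with τ h1 h2 hτ
    have h0 : 0 ≤ t - τ := by linarith [hτ.2]
    -- This is `A v = g - d` with `R = (l + A)⁻¹` applied; it makes the terms from `E'` and from `d`
    -- combine to `E g`.
    have h3 : R (g τ) = v τ - l • R (v τ) + R (d τ) := by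
      have := hgraph _ _ h2
      rw [h1, map_add, map_sub, ContinuousLinearMap.map_smul_of_tower] at this
      calc R (g τ) = (l • R (v τ) + (R (g τ) - R (d τ))) - l • R (v τ) + R (d τ) := by abel
        _ = _ := by rw [this]
    simp only [neg_apply, add_apply, FunLike.coe_smul, Pi.smul_apply, hE _ h0, hE' _ h0, h1, h3,
      map_add, map_sub, ContinuousLinearMap.map_smul_of_tower, smul_add, smul_sub]
    abel
  rw [intervalIntegral.integral_sub ig if'] at e
  rw [add_sub_assoc, ← e]
  abel

end Regularized

/-! ### Telescoping and removal of the regularization. -/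

theorem hasDerivAt_pow_succ_div_factorial (k : ℕ) (x : ℝ) :
    HasDerivAt (fun x : ℝ => x ^ (k + 1) / ((k + 1).factorial : ℝ)) (x ^ k / (k.factorial : ℝ)) x := by
  have h := (hasDerivAt_pow (k + 1) x).div_const ((k + 1).factorial : ℝ)
  have e : ((k + 1 : ℕ) : ℝ) * x ^ (k + 1 - 1) / ((k + 1).factorial : ℝ) =
      x ^ k / (k.factorial : ℝ) := by
    have : (k.factorial : ℝ) ≠ 0 := by positivity
    rw [Nat.factorial_succ, Nat.add_sub_cancel]
    push_cast
    field_simp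
  rw [← e]
  exact h

end ParabolicCalculus

theorem propositionA4 {X : Type*} [NormedAddCommGroup X] [NormedSpace ℂ X] [CompleteSpace X]
    (S : ℝ → X →L[ℂ] X) (A : X →ₗ.[ℂ] X)
    (hS : IsMeasurableSemigroup S) (hA : IsGenerator S (-A)) (hexp : IsUniformlyExpStable S)
    (n : ℕ) (hn : 1 ≤ n) (p : ℝ≥0∞) [Fact (1 ≤ p)] (t₀ : ℝ)
    (u : LpJ X p t₀) (hu : u ∈ (powPMap (parabolicOp A p t₀) n).domain) :
    -- the functions `(∂ₜ + A)^k u`, `k < n`, have continuous representatives on `[t₀, ∞)`, ...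
    (∀ k, ∀ hk : k < n, ∃ g : ℝ → X,
      IsContRep (powPMap (parabolicOp A p t₀) k ⟨u, mem_powPMap_domain_of_le hk.le hu⟩) g) ∧
    -- ... and the formula holds for these at every point; note `(∂ₜ + A)^0 u = u`
    ∀ v : ℕ → ℝ → X,
      (∀ k, ∀ hk : k < n, IsContRep
        (powPMap (parabolicOp A p t₀) k ⟨u, mem_powPMap_domain_of_le hk.le hu⟩) (v k)) →
      ∀ t ∈ Ici t₀,
        IntervalIntegrable
          (parabolicIntegrand S n t (powPMap (parabolicOp A p t₀) n ⟨u, hu⟩)) volume t₀ t ∧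
        v 0 t =
          parabolicIntegral S n t₀ (powPMap (parabolicOp A p t₀) n ⟨u, hu⟩) t +
            ∑ k ∈ Finset.range n,
              ((t - t₀) ^ k / (k.factorial : ℝ)) • S (t - t₀) (v k t₀) := by
  have hp : 1 ≤ p := Fact.out
  have hstep : ∀ k (hk : k < n), ∃ d : LpJ X p t₀,
      IsWeakDeriv (powPMap (parabolicOp A p t₀) k ⟨u, mem_powPMap_domain_of_le hk.le hu⟩) d ∧
      ∀ᵐ t ∂(volume.restrict (Ioi t₀)),
        (powPMap (parabolicOp A p t₀) k ⟨u, mem_powPMap_domain_of_le hk.le hu⟩ t,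
          powPMap (parabolicOp A p t₀) (k + 1)
            ⟨u, mem_powPMap_domain_of_le (Nat.succ_le_of_lt hk) hu⟩ t - d t) ∈ A.graph := by
    intro k hk
    obtain ⟨h, e⟩ := powPMap_succ_apply (parabolicOp A p t₀) k u
      (mem_powPMap_domain_of_le hk.le hu) (mem_powPMap_domain_of_le (Nat.succ_le_of_lt hk) hu)
    rw [← e]
    exact exists_weakDeriv_of_mem_parabolicOp_domain h
  refine ⟨fun k hk => ?_, fun v hv t ht => ?_⟩
  · obtain ⟨d, hd, -⟩ := hstep k hk
    obtain ⟨c, hc⟩ := hd.exists_isContRep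
    exact ⟨_, hc⟩
  have hint : ∀ f : LpJ X p t₀, IntegrableOn f (Ioc t₀ t) := fun f =>
    integrableOn_of_locallyIntegrable_restrict ((Lp.memLp f).locallyIntegrable hp) t
  have hres : ∀ {P : ℝ → Prop}, (∀ᵐ τ ∂(volume.restrict (Ioi t₀)), P τ) →
      ∀ᵐ τ ∂(volume.restrict (Ioc t₀ t)), P τ := fun h =>
    ae_restrict_of_ae_restrict_of_subset Ioc_subset_Ioi_self h
  obtain ⟨m, rfl⟩ : ∃ m, n = m + 1 := ⟨n - 1, by omega⟩
  have hI := intervalIntegrable_parabolicIntegrand hS m (mem_Ici.1 ht)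
    (hint (powPMap (parabolicOp A p t₀) (m + 1) ⟨u, hu⟩))
  refine ⟨hI, ?_⟩
  obtain ⟨l, R, E, E', hinj, hgraph, hcomm, hE, hE', hEd, hEc⟩ :=
    exists_regularized_semigroup hS hA hexp
  have hE0 : ∀ x, E 0 x = R (R x) := fun x => by rw [hE 0 le_rfl, hS.map_zero]; rfl
  -- The formula at each order `k + 1`, with `R²` applied. For `k = 0` the weight is constant `1`,
  -- giving the term `R² u(t)`; later weights vanish at `0` and add only a boundary term at `t₀`.
  have htele : ∀ k (hk : k < m + 1),
      ∫ τ in t₀..t, ((t - τ) ^ k / (k.factorial : ℝ)) • E (t - τ)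
        (powPMap (parabolicOp A p t₀) (k + 1)
          ⟨u, mem_powPMap_domain_of_le (Nat.succ_le_of_lt hk) hu⟩ τ) =
      R (R (v 0 t)) - ∑ j ∈ Finset.range (k + 1),
        ((t - t₀) ^ j / (j.factorial : ℝ)) • E (t - t₀) (v j t₀) := by
    intro k hk
    induction k with
    | zero =>
      obtain ⟨d, hd, hdA⟩ := hstep 0 hk
      have := integral_regularized_by_parts hgraph hE hE' hEd hEc
        (a := fun _ => 1) (a' := fun _ => 0) (fun s => hasDerivAt_const s 1) continuous_const
        (mem_Ici.1 ht) (hint _) (hint _) (hint d)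
        (fun τ hτ => hd.eq_add_primitive (hv 0 hk) hτ.1) (hres (hv 0 hk).2) (hres hdA)
      simpa [hE0] using this
    | succ k ih =>
      obtain ⟨d, hd, hdA⟩ := hstep (k + 1) hk
      have := integral_regularized_by_parts hgraph hE hE' hEd hEc
        (hasDerivAt_pow_succ_div_factorial k) (by fun_prop)
        (mem_Ici.1 ht) (hint _) (hint _) (hint d)
        (fun τ hτ => hd.eq_add_primitive (hv (k + 1) hk) hτ.1) (hres (hv (k + 1) hk).2)
        (hres hdA)
      rw [this, ih (by omega), Finset.sum_range_succ _ (k + 1)]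
      simp [sub_sub]
  have hfin := htele m (Nat.lt_succ_self m)
  have htt : 0 ≤ t - t₀ := sub_nonneg.2 ht
  have hRS : ∀ s, 0 ≤ s → ∀ x, R (R (S s x)) = E s x := fun s hs x => by
    rw [hcomm s hs, hcomm s hs, hE s hs]
  -- `R²` passes under the Bochner integral and through `S(t - τ)`, and `Γ(m + 1) = m!`.
  have hpar : R (R (parabolicIntegral S ((m + 1 : ℕ) : ℝ) t₀
      (powPMap (parabolicOp A p t₀) (m + 1) ⟨u, hu⟩) t)) =
      ∫ τ in t₀..t, ((t - τ) ^ m / (m.factorial : ℝ)) • E (t - τ)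
        (powPMap (parabolicOp A p t₀) (m + 1) ⟨u, hu⟩ τ) := by
    have hΓ : Real.Gamma ((m + 1 : ℕ) : ℝ) = m.factorial := by
      push_cast; exact Real.Gamma_nat_eq_factorial m
    rw [parabolicIntegral, ContinuousLinearMap.map_smul_of_tower,
      ContinuousLinearMap.map_smul_of_tower, hΓ,
      ← ContinuousLinearMap.comp_apply, ← ContinuousLinearMap.intervalIntegral_comp_comm _ hI,
      ← intervalIntegral.integral_smul]
    refine intervalIntegral.integral_congr fun τ hτ => ?_
    rw [uIcc_of_le (mem_Ici.1 ht)] at hτ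
    simp only [parabolicIntegrand_natCast, ContinuousLinearMap.map_smul_of_tower,
      ContinuousLinearMap.comp_apply, hRS _ (sub_nonneg.2 hτ.2), smul_smul]
    congr 1
    ring
  refine hinj (hinj ?_)
  rw [map_add, map_add, hpar, hfin, map_sum, map_sum]
  simp only [ContinuousLinearMap.map_smul_of_tower, hRS _ htt, sub_add_cancel]
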